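/- A set-theoretic solution to the Pentagon Equation (PE) is a map $s:S\times S\to S\times S$ on a set $S$ with $s_{23}s_{13}s_{12}=s_{12}s_{23}$ on $S\times S\times S$. Let $(S,s)$ be a bijective solution with $S$ finite and nonempty. Write $s(x,y)=(x\cdot y,\theta_x(y))$ and $s^{-1}(x,y)=(\psi_y(x),y\circ x)$, and let $E(S,\cdot)=\{e: e\cdot e=e\}$ and $\ker\theta=\{x:\theta_x=\mathrm{id}_S\}$. For $e_0\in E(S,\cdot)$ put $1=\theta_{e_0}(e_0)$, and let $\approx$ be the relation on $S$ given by $e\cdot g\approx f\cdot h$ iff $\theta_e=\theta_f$ and $g=h$, for $e,f\in E(S,\cdot)$ and $g,h\in 1\cdot S$. A bijective solution is irretractable if its relation $\approx$ is equality. A matched pair of groups $(A,G,\sigma,\delta)$ consists of groups $A,G$, a left action $\sigma$ of $A$ on the set $G$ and a right action $\delta$ of $G$ on the set $A$ such that $\sigma_a(xy)=\sigma_a(x)\sigma_{\delta_x(a)}(y)$ and $\delta_x(ab)=\delta_{\sigma_b(x)}(a)\,\delta_x(b)$. Theorem. $E(S,\cdot)$ is nonempty, and for every $e_0\in E(S,\cdot)$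 the following hold. (1) $\approx$ is an equivalence relation, and $s$ induces a bijective solution $\overline s$ to the PE on $\overline S=S/{\approx}$ (the retract of $(S,s)$) such that the projection $\pi:S\to\overline S$ is a homomorphism of solutions, i.e. $\overline s\,(\pi\times\pi)=(\pi\times\pi)\,s$. The solution $(\overline S,\overline s)$ is irretractable. (2) Write $\cdot,\circ,\theta,\psi$ also for the operations of $(\overline S,\overline s)$ and $1=\theta_{\pi(e_0)}(\pi(e_0))\in\overline S$. Then $A=1\circ\overline S$ is a group under $\circ$, $G=1\cdot\overline S$ is a group under $\cdot$, and $\sigma_a(x)=1\cdot\theta_a(x)$, $\delta_x(a)=\bigl(1\circ\psi_{x^{-1}}(a^{-1})\bigr)^{-1}$ make $(A,G,\sigma,\delta)$ a matched pair of groups. The map $A\times G\to\overline S$, $(a,x)\mapsto a\cdot x$, is an isomorphism of solutions from $A\times G$ with the map $$((a,x),(b,y))\mapsto\bigl((a,xy),\,(b\,\delta_x(a)^{-1},\,\sigma_{\delta_x(a)}(y))\bigr)$$ onto $(\overline S,\overline s)$. (3) $(S,s)$ is an extension $\mathrm{Ext}_X^{\varphi}(\overline S,\overline s)$ of its retract by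 $X=\ker\theta\cap E(S,\cdot)$, where $\ker\theta$ and $E(S,\cdot)$ are those of $(S,s)$. That is, there are permutations $\varphi_a$ of $X$, for $a\in A$, and a bijection $F:S\to X\times A\times G$ which is an isomorphism of solutions from $(S,s)$ onto $X\times A\times G$ with the map $$((\alpha,a,x),(\beta,b,y))\mapsto\Bigl((\alpha,a,xy),\ \bigl(\varphi_{b\delta_x(a)^{-1}}^{-1}\varphi_b(\beta),\ b\,\delta_x(a)^{-1},\ \sigma_{\delta_x(a)}(y)\bigr)\Bigr),$$ and which lies over $\overline S$: if $F(p)=(\alpha,a,x)$, then $\pi(p)=a\cdot x$. -/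

import Mathlib

universe u v

namespace PE

/-! ### Set-theoretic solutions of the Pentagon Equation -/

section Basic

variable {S : Type u} {T : Type v}

/-- `s × id` on `S × S × S`. -/
def s12 (s : S × S → S × S) (p : S × S × S) : S × S × S :=
  ((s (p.1, p.2.1)).1, (s (p.1, p.2.1)).2, p.2.2)

/-- `s` applied to the first and the third component. -/
def s13 (s : S × S → S × S) (p : S × S × S) : S × S × S :=
  ((s (p.1, p.2.2)).1, p.2.1, (s (p.1, p.2.2)).2)

/-- `id × s` on `S × S × S`. -/
def s23 (s : S × S → S × S) (p : S × S × S) : S × S × S :=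
  (p.1, s p.2)

/-- The set-theoretic Pentagon Equation `s₂₃ s₁₃ s₁₂ = s₁₂ s₂₃`. -/
def IsSolution (s : S × S → S × S) : Prop :=
  s23 s ∘ s13 s ∘ s12 s = s12 s ∘ s23 s

/-- `f` is a homomorphism of solutions from `(S, s)` to `(T, t)`. -/
def IsHom (s : S × S → S × S) (t : T × T → T × T) (f : S → T) : Prop :=
  ∀ p : S × S, t (Prod.map f f p) = Prod.map f f (s p)

/-- An isomorphism of solutions is a bijective homomorphism. -/
def IsIso (s : S × S → S × S) (t : T × T → T × T) (f : S → T) : Prop :=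
  IsHom s t f ∧ Function.Bijective f

end Basic

/-! ### The operations of a bijective solution:
`s (x, y) = (x · y, θ_x y)` and `s⁻¹ (x, y) = (ψ_y x, y ∘ x)` -/

section Operations

variable {S : Type u}

/-- The product `x · y`. -/
def mul (s : Equiv.Perm (S × S)) (x y : S) : S := (s (x, y)).1

/-- The map `θ_x`. -/
def theta (s : Equiv.Perm (S × S)) (x : S) : S → S := fun y => (s (x, y)).2

/-- The map `ψ_y`. -/
def psi (s : Equiv.Perm (S × S)) (y : S) : S → S := fun x => (s.symm (x, y)).1

/-- The dual product `y ∘ x`. -/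
def circ (s : Equiv.Perm (S × S)) (y x : S) : S := (s.symm (x, y)).2

/-- `E(S, ·)`. -/
def idempotents (s : Equiv.Perm (S × S)) : Set S := {e | mul s e e = e}

/-- `ker θ = {x | θ_x = id}`. -/
def kerTheta (s : Equiv.Perm (S × S)) : Set S := {x | theta s x = id}

/-- The element `1 = θ_{e₀}(e₀)` determined by a chosen idempotent `e₀`. -/
def one (s : Equiv.Perm (S × S)) (e₀ : S) : S := theta s e₀ e₀

/-- `1 · S`. -/
def dotSet (s : Equiv.Perm (S × S)) (e₀ : S) : Set S := Set.range (mul s (one s e₀))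

/-- `1 ∘ S`. -/
def circSet (s : Equiv.Perm (S × S)) (e₀ : S) : Set S := Set.range (circ s (one s e₀))

/-! ### The retract -/

/-- The relation `e · g ≈ f · h ↔ θ_e = θ_f and g = h`, for `e, f ∈ E(S, ·)` and `g, h ∈ 1 · S`. -/
def RetractRel (s : Equiv.Perm (S × S)) (e₀ : S) (x y : S) : Prop :=
  ∃ e ∈ idempotents s, ∃ f ∈ idempotents s, ∃ g ∈ dotSet s e₀, ∃ h ∈ dotSet s e₀,
    x = mul s e g ∧ y = mul s f h ∧ theta s e = theta s f ∧ g = h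

/-- The underlying set of the retract. -/
def Retract (s : Equiv.Perm (S × S)) (e₀ : S) : Type u := Quot (RetractRel s e₀)

/-- The canonical projection onto the retract. -/
def toRetract (s : Equiv.Perm (S × S)) (e₀ : S) : S → Retract s e₀ := Quot.mk (RetractRel s e₀)

/-- A bijective solution is irretractable if it equals its retract. -/
def IsIrretractable (s : Equiv.Perm (S × S)) (e₀ : S) : Prop :=
  ∀ x y : S, RetractRel s e₀ x y ↔ x = y

end Operations

/-! ### Matched pairs of groups -/

/-- A matched pair of groups: a left action `σ` of `A` on the set `G` and a right action `δ` of
`G` on the set `A` with the two compatibility conditions. -/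
structure MatchedPair (A : Type u) (G : Type v) [Group A] [Group G] where
  σ : A →* Equiv.Perm G
  δ : G → Equiv.Perm A
  δ_one : δ 1 = 1
  δ_mul : ∀ (x y : G) (a : A), δ (x * y) a = δ y (δ x a)
  σ_mul_right : ∀ (a : A) (x y : G), σ a (x * y) = σ a x * σ (δ x a) y
  δ_mul_right : ∀ (x : G) (a b : A), δ x (a * b) = δ (σ b x) a * δ x b

namespace MatchedPair

variable {A : Type u} {G : Type u} [Group A] [Group G]

/-- The solution on `A × G` associated to a matched pair. -/
def sol (M : MatchedPair A G) : (A × G) × (A × G) → (A × G) × (A × G) :=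
  fun ((a, x), (b, y)) => ((a, x * y), (b * (M.δ x a)⁻¹, M.σ (M.δ x a) y))

/-- The extension by a set `X` and permutations `φ_a`, `a ∈ A`, of the solution on `A × G`
associated to a matched pair. -/
def ext (M : MatchedPair A G) {X : Type v} (φ : A → Equiv.Perm X) :
    (X × A × G) × (X × A × G) → (X × A × G) × (X × A × G) :=
  fun ((α, a, x), (β, b, y)) =>
    ((α, a, x * y),
      ((φ (b * (M.δ x a)⁻¹))⁻¹ (φ b β), b * (M.δ x a)⁻¹, M.σ (M.δ x a) y))

end MatchedPair

/-- The matched pair of an irretractable bijective solution `(T, t)`: the sets `A = 1 ∘ T` and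
`G = 1 · T` are groups under `∘` and `·`, with `σ_a(x) = 1 · θ_a(x)`,
`δ_x(a) = (1 ∘ ψ_{x⁻¹}(a⁻¹))⁻¹`, and `(a, x) ↦ a · x` identifies the solution associated to the
matched pair with `(T, t)`. -/
structure IsMatchedPairOf {T : Type u} (t : Equiv.Perm (T × T)) (e₀ : T)
    [Group (circSet t e₀)] [Group (dotSet t e₀)]
    (M : MatchedPair (circSet t e₀) (dotSet t e₀)) : Prop where
  coe_mul_circ : ∀ a b : circSet t e₀, ((a * b : circSet t e₀) : T) = circ t a b
  coe_mul_dot : ∀ x y : dotSet t e₀, ((x * y : dotSet t e₀) : T) = mul t x y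
  coe_σ : ∀ (a : circSet t e₀) (x : dotSet t e₀),
    (M.σ a x : T) = mul t (one t e₀) (theta t a x)
  coe_δ_inv : ∀ (x : dotSet t e₀) (a : circSet t e₀),
    (((M.δ x a)⁻¹ : circSet t e₀) : T) =
      circ t (one t e₀) (psi t (x⁻¹ : dotSet t e₀) (a⁻¹ : circSet t e₀))
  isIso : IsIso M.sol t (fun p => mul t p.1 p.2)

end PE

namespace PE

/-! ### The pentagon identities, the dual solution, and `(S, ·)` as a left group. -/

section LeftGroup

variable {S : Type u} {s : Equiv.Perm (S × S)}

/-! The first step is that finiteness makes `(S, ·)` a left group: right multiplications are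
bijective (`exists_mul_eq`), idempotents are right identities, and every `x` is recovered from its
idempotent component `idem x` and its group component `1 · x`. The second is that every `θ_x` is
bijective (`theta_bijective`). The dual solution `τ s⁻¹ τ` satisfies the same hypotheses, so each
result also holds for `∘` and `ψ`; in particular `ker θ = E(S, ∘)` and `ker ψ = E(S, ·)`.

The retract remembers only `θ` of the idempotent component, together with `1 · x`. Since `θ` turns
`∘` into composition and `1 ∘ x` depends only on `θ_x` (`circ_eq_of_theta_eq`), elements of `A` can
be compared through their maps `θ`. The matched pair axioms then become the pentagon identities. In
an irretractable solution `A` exhausts the idempotents, so `a · x` is the left group decomposition.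

What the retract forgets is recovered by `θ_e(e)`, where `e = idem x`: bijectivity of `θ_e` lets
`θ_e` and `θ_e(e)` determine `e`. This coordinate lies in `ker θ ∩ E(S, ·)` and `s` preserves it in
both arguments, so the extension can be taken with all `φ_a` trivial. -/

theorem mul_assoc (hs : IsSolution s) (x y z : S) :
    mul s (mul s x y) z = mul s x (mul s y z) :=
  congrArg (fun p => p.1) (congrFun hs (x, y, z))

theorem theta_mul (hs : IsSolution s) (x y z : S) :
    theta s x (mul s y z) = mul s (theta s x y) (theta s (mul s x y) z) :=
  (congrArg (fun p => p.2.1) (congrFun hs (x, y, z))).symm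

theorem theta_theta (hs : IsSolution s) (x y z : S) :
    theta s (theta s x y) (theta s (mul s x y) z) = theta s y z :=
  congrArg (fun p => p.2.2) (congrFun hs (x, y, z))

theorem isSolution_of_identities
    (h₁ : ∀ x y z : S, mul s (mul s x y) z = mul s x (mul s y z))
    (h₂ : ∀ x y z : S, theta s x (mul s y z) = mul s (theta s x y) (theta s (mul s x y) z))
    (h₃ : ∀ x y z : S, theta s (theta s x y) (theta s (mul s x y) z) = theta s y z) :
    IsSolution s := by
  funext ⟨x, y, z⟩
  exact Prod.ext (h₁ x y z) (Prod.ext (h₂ x y z).symm (h₃ x y z))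

theorem mul_psi_circ (x y : S) : mul s (psi s y x) (circ s y x) = x :=
  congrArg Prod.fst (s.apply_symm_apply (x, y))

theorem theta_psi_circ (x y : S) : theta s (psi s y x) (circ s y x) = y :=
  congrArg Prod.snd (s.apply_symm_apply (x, y))

theorem psi_theta_mul (x y : S) : psi s (theta s x y) (mul s x y) = x :=
  congrArg Prod.fst (s.symm_apply_apply (x, y))

theorem circ_theta_mul (x y : S) : circ s (theta s x y) (mul s x y) = y :=
  congrArg Prod.snd (s.symm_apply_apply (x, y))

theorem eq_of_mul_eq_of_theta_eq {x y x' y' : S} (h₁ : mul s x y = mul s x' y')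
    (h₂ : theta s x y = theta s x' y') : x = x' ∧ y = y' :=
  Prod.ext_iff.1 (s.injective (Prod.ext h₁ h₂ : s (x, y) = s (x', y')))

theorem theta_circ (hs : IsSolution s) (x y z : S) :
    theta s (circ s x y) z = theta s x (theta s y z) := by
  have h := theta_theta hs (psi s x y) (circ s x y) z
  rwa [mul_psi_circ, theta_psi_circ, eq_comm] at h

/-- The dual solution `τ s⁻¹ τ`, whose operations are `∘` and `ψ`. -/
def dual (s : Equiv.Perm (S × S)) : Equiv.Perm (S × S) :=
  (Equiv.prodComm S S).trans (s.symm.trans (Equiv.prodComm S S))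

theorem mul_dual : mul (dual s) = circ s := rfl

theorem isSolution_dual (hs : IsSolution s) : IsSolution (dual s) := by
  have key : ∀ x y z : S,
      circ s (circ s x y) z = circ s x (circ s y z) ∧
      psi s x (circ s y z) = circ s (psi s x y) (psi s (circ s x y) z) ∧
      psi s (psi s x y) (psi s (circ s x y) z) = psi s y z := by
    intro x y z
    -- Writing the arguments as outputs of `s` makes every occurrence of `s⁻¹` computable, and the
    -- dual identities reduce to those of `s`.
    obtain ⟨c, p, rfl, rfl⟩ : ∃ c p, mul s c p = z ∧ theta s c p = y :=
      ⟨_, _, mul_psi_circ z y, theta_psi_circ z y⟩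
    obtain ⟨b, r, rfl, rfl⟩ : ∃ b r, mul s b r = p ∧ theta s b r = x :=
      ⟨_, _, mul_psi_circ p x, theta_psi_circ p x⟩
    have h₁ : circ s (theta s b r) (theta s c (mul s b r)) = theta s (mul s c b) r := by
      rw [theta_mul hs, ← theta_theta hs c b r, circ_theta_mul]
    have h₂ : psi s (theta s b r) (theta s c (mul s b r)) = theta s c b := by
      rw [theta_mul hs, ← theta_theta hs c b r, psi_theta_mul]
    have h₃ : psi s (theta s (mul s c b) r) (mul s c (mul s b r)) = mul s c b := by
      rw [← mul_assoc hs, psi_theta_mul]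
    have h₄ : circ s (theta s (mul s c b) r) (mul s c (mul s b r)) = r := by
      rw [← mul_assoc hs, circ_theta_mul]
    rw [h₁, h₂, h₃, h₄]
    simp only [circ_theta_mul, psi_theta_mul, and_self]
  exact isSolution_of_identities (fun x y z => (key x y z).1) (fun x y z => (key x y z).2.1)
    (fun x y z => (key x y z).2.2)

/-- For a left ideal `L`, `s` maps `S × L` injectively into `L × S`. The two sets have the same
size, so nothing outside `S × L` can land in `L × S`. -/
theorem mem_of_mul_mem [Finite S] {L : Set S} (hL : ∀ x y, y ∈ L → mul s x y ∈ L) {x y : S}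
    (h : mul s x y ∈ L) : y ∈ L := by
  have hsub : s '' (Set.univ ×ˢ L) ⊆ L ×ˢ Set.univ := by
    rintro _ ⟨⟨a, b⟩, hab, rfl⟩
    exact ⟨hL a b hab.2, trivial⟩
  have heq : s '' (Set.univ ×ˢ L) = L ×ˢ Set.univ := by
    refine Set.eq_of_subset_of_ncard_le hsub ?_ (Set.toFinite _)
    rw [Set.ncard_image_of_injective _ s.injective, Set.ncard_prod, Set.ncard_prod, mul_comm]
  have hmem : s (x, y) ∈ L ×ˢ (Set.univ : Set S) := ⟨h, trivial⟩
  rw [← heq] at hmem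
  obtain ⟨p, hp, hps⟩ := hmem
  rw [s.injective hps] at hp
  exact hp.2

theorem idempotents_nonempty [Finite S] [Nonempty S] (hs : IsSolution s) :
    (idempotents s).Nonempty := by
  let _ : Semigroup S := { mul := mul s, mul_assoc := mul_assoc hs }
  let _ : TopologicalSpace S := ⊥
  have : DiscreteTopology S := ⟨rfl⟩
  exact exists_idempotent_of_compact_t2_of_continuous_mul_left
    (M := S) fun _ => continuous_of_discreteTopology

variable [Finite S]

/-- For an idempotent `e`, writing `(e, v)` as a value of `s` and using the left ideal `S · e` shows
that `θ_e(e)` is a right identity. As `z · z` is a left multiple of `θ_e(e)`, the left ideal `S · z`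
contains `θ_e(e)`, hence everything. -/
theorem exists_mul_eq (hs : IsSolution s) (z v : S) : ∃ x, mul s x z = v := by
  have : Nonempty S := ⟨z⟩
  obtain ⟨e, he⟩ := idempotents_nonempty hs
  have ideal : ∀ w x y, y ∈ Set.range (fun a => mul s a w) →
      mul s x y ∈ Set.range (fun a => mul s a w) := by
    rintro w x _ ⟨a, rfl⟩
    exact ⟨mul s x a, mul_assoc hs x a w⟩
  have hone : ∀ v, ∃ x, mul s x (theta s e e) = v := by
    intro v
    have hmul := mul_psi_circ (s := s) e v
    obtain ⟨a, ha⟩ := mem_of_mul_mem (ideal e) (x := psi s v e) (y := circ s v e)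
      ⟨e, by rw [hmul]; exact he⟩
    have h := theta_mul hs (psi s v e) (circ s v e) e
    have ha' : mul s (circ s v e) e = circ s v e := by
      rw [← ha]
      change mul s (mul s a e) e = mul s a e
      rw [mul_assoc hs, show mul s e e = e from he]
    rw [ha', theta_psi_circ, hmul] at h
    exact ⟨_, h.symm⟩
  obtain ⟨x, hx⟩ := hone (mul s z z)
  obtain ⟨w, hw⟩ := hone v
  obtain ⟨a, ha⟩ := ideal z w _ (mem_of_mul_mem (ideal z) (x := x) ⟨z, hx.symm⟩)
  exact ⟨a, ha.trans hw⟩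

theorem mul_right_cancel (hs : IsSolution s) {x y z : S} (h : mul s x z = mul s y z) : x = y :=
  Finite.injective_iff_surjective.2 (exists_mul_eq hs z) h

theorem mul_idempotent (hs : IsSolution s) {e : S} (he : e ∈ idempotents s) (x : S) :
    mul s x e = x :=
  mul_right_cancel hs (z := e) (by rw [mul_assoc hs, show mul s e e = e from he])

theorem mul_left_cancel_of_idempotent (hs : IsSolution s) {w y z : S} (h : mul s w y = mul s w z)
    (u : S) : mul s u y = mul s u z := by
  obtain ⟨v, rfl⟩ := exists_mul_eq hs w u
  rw [mul_assoc hs, h, mul_assoc hs]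

theorem mem_idempotents_of_mul_eq (hs : IsSolution s) {x e : S} (h : mul s x e = x) :
    e ∈ idempotents s := by
  obtain ⟨v, rfl⟩ := exists_mul_eq hs x e
  change mul s (mul s v x) (mul s v x) = _
  rw [mul_assoc hs, h]

theorem mul_mul_idempotent_mul (hs : IsSolution s) {u : S} (hu : u ∈ idempotents s) (x y : S) :
    mul s x (mul s u y) = mul s x y := by
  rw [← mul_assoc hs, mul_idempotent hs hu]

theorem exists_idempotent_mul_eq (hs : IsSolution s) (x : S) :
    ∃ e ∈ idempotents s, mul s e x = x := by
  obtain ⟨e, he⟩ := exists_mul_eq hs x x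
  exact ⟨e, mul_right_cancel hs (z := x) (by rw [mul_assoc hs, he, he]), he⟩

end LeftGroup

/-! ### Bijectivity of `θ`, and its kernel and fibres. -/

section Theta

variable {S : Type u} {s : Equiv.Perm (S × S)}

theorem theta_mem_idempotents (hs : IsSolution s) [Finite S] (x : S) {e : S}
    (he : e ∈ idempotents s) : theta s x e ∈ idempotents s := by
  have h := theta_mul hs x e e
  rw [show mul s e e = e from he, mul_idempotent hs he] at h
  exact h.symm

theorem theta_circ_of_mem_ker (hs : IsSolution s) {u : S} (hu : theta s u = id) (x : S) :
    theta s (circ s u x) = theta s x := by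
  funext y
  rw [theta_circ hs, hu, id]

variable [Finite S]

theorem theta_idempotent_mul (hs : IsSolution s) {e : S} (he : e ∈ idempotents s) (x y : S) :
    theta s x (mul s e y) = mul s (theta s x e) (theta s x y) := by
  rw [theta_mul hs, mul_idempotent hs he]

theorem theta_theta_idempotent (hs : IsSolution s) {e : S} (he : e ∈ idempotents s) (x y : S) :
    theta s (theta s x e) (theta s x y) = theta s e y := by
  have h := theta_theta hs x e y
  rwa [mul_idempotent hs he] at h

theorem mul_theta_mul (hs : IsSolution s) {u : S} (hu : u ∈ idempotents s) (x y : S) :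
    mul s u (theta s x (mul s u y)) = mul s u (theta s x y) := by
  rw [theta_idempotent_mul hs hu, mul_mul_idempotent_mul hs (theta_mem_idempotents hs x hu)]

theorem eq_of_theta_eq_of_mul_eq (hs : IsSolution s) {u x y z : S} (h : theta s x y = theta s x z)
    (hyz : mul s u y = mul s u z) : y = z :=
  (eq_of_mul_eq_of_theta_eq (mul_left_cancel_of_idempotent hs hyz x) h).2

/-- Some idempotent is mapped by `θ_x` to a given idempotent. -/
theorem exists_idempotent_theta_eq (hs : IsSolution s) (x : S) {f : S} (hf : f ∈ idempotents s) :
    ∃ e ∈ idempotents s, theta s x e = f := by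
  -- On idempotents `s (x, e) = (x, θ_x e)`, so injectivity of `s` passes to `θ_x`.
  have hinj : Function.Injective
      (fun e : idempotents s =>
        (⟨theta s x e, theta_mem_idempotents hs x e.2⟩ : idempotents s)) := by
    intro a b hab
    refine Subtype.ext (eq_of_theta_eq_of_mul_eq hs (u := x) (congrArg Subtype.val hab) ?_)
    rw [mul_idempotent hs a.2, mul_idempotent hs b.2]
  obtain ⟨e, he⟩ := Finite.injective_iff_surjective.1 hinj ⟨f, hf⟩
  exact ⟨e, e.2, congrArg Subtype.val he⟩

/-- If `θ_x` identifies `y` and `z`, it suffices, by injectivity of `s`, that their group components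
agree. With `w · z = u` idempotent, this amounts to `w · y` being idempotent too. -/
theorem theta_bijective (hs : IsSolution s) (x : S) : Function.Bijective (theta s x) := by
  refine Finite.injective_iff_bijective.1 fun y z hyz => ?_
  obtain ⟨u, hu, -⟩ := exists_idempotent_mul_eq hs x
  -- Choosing `v · w = x` factors `θ_w` through `θ_x`.
  have hall : ∀ w, theta s w y = theta s w z := by
    intro w
    obtain ⟨v, hv⟩ := exists_mul_eq hs w x
    rw [← theta_theta hs v w y, ← theta_theta hs v w z, hv, hyz]
  obtain ⟨w, hw⟩ := exists_mul_eq hs z u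
  have hzw : mul s z w ∈ idempotents s := by
    change mul s (mul s z w) (mul s z w) = _
    rw [mul_assoc hs, ← mul_assoc hs w, hw, mul_mul_idempotent_mul hs hu]
  have hzk : mul s z (mul s w y) = mul s (mul s z w) y := (mul_assoc hs _ _ _).symm
  -- Expanding `θ_v(z · w · y)` in two ways shows that `θ_{v · z}(w · y)` acts as a right identity
  -- on `θ_v(z)`.
  have huk : ∀ v, mul s u (theta s (mul s v z) (mul s w y)) = u := by
    intro v
    have h₁ := theta_mul hs v z (mul s w y)
    rw [hzk, theta_idempotent_mul hs hzw, hall v] at h₁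
    have h₂ : mul s u (theta s v z) =
        mul s u (mul s (theta s v z) (theta s (mul s v z) (mul s w y))) := by
      rw [← h₁, mul_mul_idempotent_mul hs (theta_mem_idempotents hs v hzw)]
    rw [← mul_assoc hs] at h₂
    have h₃ := mul_left_cancel_of_idempotent hs
      (h₂.symm.trans (mul_idempotent hs hu _).symm) u
    rw [h₃, show mul s u u = u from hu]
  obtain ⟨v, hv⟩ := exists_mul_eq hs (mul s w y) u
  obtain ⟨v', rfl⟩ := exists_mul_eq hs z v
  have hf : theta s (mul s v' z) (mul s w y) ∈ idempotents s :=
    mem_idempotents_of_mul_eq hs (huk v')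
  -- Now `s (v' · z, w · y)` equals `s (u, k)` with `k` idempotent, which forces `w · y = k`.
  obtain ⟨k, hk, hkf⟩ := exists_idempotent_theta_eq hs u hf
  have hwk : mul s w y = k :=
    (eq_of_mul_eq_of_theta_eq (hv.trans (mul_idempotent hs hk u).symm) hkf.symm).2
  refine eq_of_theta_eq_of_mul_eq hs (u := mul s z w) hyz ?_
  rw [← hzk, hwk, mul_idempotent hs hk, mul_assoc hs, hw, mul_idempotent hs hu]

theorem theta_theta_self_eq_id (hs : IsSolution s) {e : S} (he : e ∈ idempotents s) :
    theta s (theta s e e) = id := by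
  funext y
  obtain ⟨z, rfl⟩ := (theta_bijective hs e).2 y
  exact theta_theta_idempotent hs he e z

theorem theta_eq_id_of_circ_idempotent (hs : IsSolution s) {f : S} (hf : circ s f f = f) :
    theta s f = id := by
  funext y
  apply (theta_bijective hs f).1
  rw [← theta_circ hs, hf, id]

theorem mem_idempotents_of_psi_eq_id (hs : IsSolution s) {g : S} (hg : psi s g = id) :
    g ∈ idempotents s := by
  have h₁ := mul_psi_circ (s := s) g g
  have h₂ := theta_psi_circ (s := s) g g
  rw [hg, id] at h₁ h₂
  rw [← h₂]
  exact theta_mem_idempotents hs g (mem_idempotents_of_mul_eq hs h₁)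

theorem circ_self_of_theta_eq_id (hs : IsSolution s) {x : S} (hx : theta s x = id) :
    circ s x x = x :=
  mem_idempotents_of_psi_eq_id (isSolution_dual hs) hx

theorem psi_eq_id_of_idempotent (hs : IsSolution s) {e : S} (he : e ∈ idempotents s) :
    psi s e = id :=
  theta_eq_id_of_circ_idempotent (isSolution_dual hs) he

theorem one_mem (hs : IsSolution s) {e : S} (he : e ∈ idempotents s) :
    one s e ∈ kerTheta s ∩ idempotents s :=
  ⟨theta_theta_self_eq_id hs he, theta_mem_idempotents hs e he⟩

theorem theta_mul_eq_id (hs : IsSolution s) {u : S} (hu : theta s u = id) (x : S) :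
    theta s (mul s u x) = id := by
  funext y
  apply (theta_bijective hs x).1
  have h := theta_theta hs u x y
  rwa [hu] at h

theorem theta_theta_mul_eq_id (hs : IsSolution s) {u : S} (hu : u ∈ kerTheta s ∩ idempotents s)
    (x y : S) : theta s (theta s x u) (theta s x y) = y := by
  rw [theta_theta_idempotent hs hu.2, show theta s u = id from hu.1, id]

/-- Since `θ_{θ_z(y)} θ_{z·y} = θ_y`, the images of `y` under `θ_z` and `θ_w` determine the two
maps. This makes `θ` constant on retract classes and underlies the action `δ`. -/
theorem theta_mul_congr (hs : IsSolution s) {z w : S} (h : theta s z = theta s w) (y : S) :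
    theta s (mul s z y) = theta s (mul s w y) := by
  funext x
  apply (theta_bijective hs (theta s z y)).1
  rw [theta_theta hs, h, theta_theta hs]

theorem circ_mem_idempotents (hs : IsSolution s) {u : S} (hu : u ∈ idempotents s) (x : S) :
    circ s u x ∈ idempotents s :=
  mem_idempotents_of_psi_eq_id hs
    (theta_mul_eq_id (isSolution_dual hs) (psi_eq_id_of_idempotent hs hu) x)

/-- With `v ∘ x = u`, both `v ∘ y` and `x ∘ v` lie in `ker θ`, so they are `∘`-idempotents.
Evaluating `u ∘ x ∘ v ∘ y` by absorbing either one gives the two sides. -/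
theorem circ_eq_of_theta_eq (hs : IsSolution s) {u x y : S} (hu : theta s u = id)
    (h : theta s x = theta s y) : circ s u x = circ s u y := by
  have hd := isSolution_dual hs
  obtain ⟨v, hv⟩ : ∃ v, circ s v x = u := exists_mul_eq hd x u
  have hvy : theta s (circ s v y) = id := by
    funext z
    rw [theta_circ hs, ← h, ← theta_circ hs, hv, hu]
  have h₁ : circ s x v ∈ idempotents (dual s) := by
    apply circ_self_of_theta_eq_id hs
    funext z
    obtain ⟨t, rfl⟩ := (theta_bijective hs x).2 z
    rw [theta_circ hs, ← theta_circ hs v x, hv, hu, id, id]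
  have h₂ := mul_idempotent hd
    (circ_self_of_theta_eq_id hs hvy : circ s v y ∈ idempotents (dual s)) x
  have h₃ := mul_assoc hd x v y
  have h₄ := mul_mul_idempotent_mul hd h₁ u y
  simp only [mul_dual] at h₂ h₃ h₄
  rw [h₃, h₂] at h₄
  exact h₄

/-- The idempotent component of `x`, i.e. the unique idempotent `e` with `e · x = x`. -/
noncomputable def idem (hs : IsSolution s) (x : S) : S :=
  (exists_idempotent_mul_eq hs x).choose

theorem idem_mem (hs : IsSolution s) (x : S) : idem hs x ∈ idempotents s :=
  (exists_idempotent_mul_eq hs x).choose_spec.1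

theorem idem_mul_self (hs : IsSolution s) (x : S) : mul s (idem hs x) x = x :=
  (exists_idempotent_mul_eq hs x).choose_spec.2

theorem idem_eq (hs : IsSolution s) {e x : S} (h : mul s e x = x) : idem hs x = e :=
  mul_right_cancel hs ((idem_mul_self hs x).trans h.symm)

theorem idem_of_mem (hs : IsSolution s) {e : S} (he : e ∈ idempotents s) : idem hs e = e :=
  idem_eq hs he

theorem idem_mul (hs : IsSolution s) (x y : S) : idem hs (mul s x y) = idem hs x :=
  idem_eq hs (by rw [← mul_assoc hs, idem_mul_self])

theorem idem_theta (hs : IsSolution s) (x y : S) :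
    idem hs (theta s x y) = theta s x (idem hs y) :=
  idem_eq hs (by rw [← theta_idempotent_mul hs (idem_mem hs y), idem_mul_self])

theorem idem_mul_mul (hs : IsSolution s) {u : S} (hu : u ∈ idempotents s) (x : S) :
    mul s (idem hs x) (mul s u x) = x := by
  rw [mul_mul_idempotent_mul hs hu, idem_mul_self]

/-- This yields the `ψ` formula for `δ`, with `b` and `y` playing the inverses of `a` and `x`.
Writing `b = c · d` with `θ_c(d) = y`, applying `θ_b` shows that the group component of `θ_b(c)`
inverts `y`, so it is that of `x`; the pentagon identity at `b` and `u · c` then gives `θ_{a·x} θ_c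
= id`. -/
theorem theta_psi_theta_mul (hs : IsSolution s) {u a b x y : S}
    (hu : u ∈ kerTheta s ∩ idempotents s) (hb : b ∈ idempotents s)
    (hab : ∀ z, theta s a (theta s b z) = z) (hxy : mul s (mul s u x) y = u) (z : S) :
    theta s (psi s y b) (theta s (mul s a x) z) = z := by
  have hcd := mul_psi_circ (s := s) b y
  have hcdy := theta_psi_circ (s := s) b y
  set c := psi s y b
  set d := circ s y b
  have hbc : mul s b c = c :=
    mul_right_cancel hs (z := d) (by rw [mul_assoc hs, hcd, show mul s b b = b from hb])
  have h₁ : mul s (theta s b c) y = theta s b (mul s c d) := by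
    rw [theta_mul hs, hbc, hcdy]
  have h₂ : mul s u (theta s b c) = mul s u x := by
    apply mul_right_cancel hs (z := y)
    rw [hxy, mul_assoc hs, h₁, hcd, mul_idempotent hs (theta_mem_idempotents hs b hb)]
  have h₃ : theta s b (mul s u c) = mul s (theta s b u) x := by
    rw [theta_idempotent_mul hs hu.2, ← mul_mul_idempotent_mul hs hu.2, h₂,
      mul_mul_idempotent_mul hs hu.2]
  have h₄ : theta s (theta s b u) = theta s a := by
    funext w
    obtain ⟨w, rfl⟩ := (theta_bijective hs b).2 w
    rw [theta_theta_mul_eq_id hs hu, hab]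
  obtain ⟨z, rfl⟩ := (theta_bijective hs c).2 z
  have h₅ := theta_theta hs b (mul s u c) z
  rw [mul_mul_idempotent_mul hs hu.2, hbc, h₃, theta_mul_congr hs h₄,
    theta_mul_eq_id hs hu.1, id] at h₅
  rw [h₅]

end Theta

/-! ### The solution induced on the retract, and its irretractability. -/

section RetractSolution

variable {S : Type u} {s : Equiv.Perm (S × S)} {e₀ : S}

theorem toRetract_surjective : Function.Surjective (toRetract s e₀) := Quot.mk_surjective

variable [Finite S]

theorem retractRel_iff (hs : IsSolution s) (he₀ : e₀ ∈ idempotents s) (x y : S) :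
    RetractRel s e₀ x y ↔ theta s (idem hs x) = theta s (idem hs y) ∧
      mul s (one s e₀) x = mul s (one s e₀) y := by
  have hu := (one_mem hs he₀).2
  constructor
  · rintro ⟨e, he, f, hf, g, hg, h, hh, rfl, rfl, hef, rfl⟩
    rw [idem_mul, idem_mul, idem_of_mem hs he, idem_of_mem hs hf]
    refine ⟨hef, ?_⟩
    rw [← mul_assoc hs, ← mul_assoc hs, mul_idempotent hs he, mul_idempotent hs hf]
  · rintro ⟨h₁, h₂⟩
    exact ⟨idem hs x, idem_mem hs x, idem hs y, idem_mem hs y, _, ⟨x, rfl⟩, _, ⟨y, rfl⟩,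
      (idem_mul_mul hs hu x).symm, (idem_mul_mul hs hu y).symm, h₁, h₂⟩

theorem retractRel_equivalence (hs : IsSolution s) (he₀ : e₀ ∈ idempotents s) :
    Equivalence (RetractRel s e₀) := by
  constructor
  · exact fun x => (retractRel_iff hs he₀ _ _).2 ⟨rfl, rfl⟩
  · intro x y h
    rw [retractRel_iff hs he₀] at h ⊢
    exact ⟨h.1.symm, h.2.symm⟩
  · intro x y z h h'
    rw [retractRel_iff hs he₀] at h h' ⊢
    exact ⟨h.1.trans h'.1, h.2.trans h'.2⟩

theorem toRetract_eq_iff (hs : IsSolution s) (he₀ : e₀ ∈ idempotents s) (x y : S) :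
    toRetract s e₀ x = toRetract s e₀ y ↔ theta s (idem hs x) = theta s (idem hs y) ∧
      mul s (one s e₀) x = mul s (one s e₀) y := by
  rw [← retractRel_iff hs he₀]
  exact (retractRel_equivalence hs he₀).quot_mk_eq_iff x y

instance : Finite (Retract s e₀) := Finite.of_surjective _ toRetract_surjective

theorem RetractRel.theta_eq (hs : IsSolution s) {x y : S}
    (h : RetractRel s e₀ x y) : theta s x = theta s y := by
  obtain ⟨e, -, f, -, g, -, h, -, rfl, rfl, hef, rfl⟩ := h
  exact theta_mul_congr hs hef g

theorem theta_theta_congr (hs : IsSolution s) {x y e f : S} (he : e ∈ idempotents s)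
    (hf : f ∈ idempotents s) (hxy : theta s x = theta s y) (hef : theta s e = theta s f) :
    theta s (theta s x e) = theta s (theta s y f) := by
  funext z
  obtain ⟨z, rfl⟩ := (theta_bijective hs x).2 z
  rw [theta_theta_idempotent hs he, hxy, theta_theta_idempotent hs hf, hef]

/-- The map induced on the retract. -/
noncomputable def retractMap (hs : IsSolution s) (he₀ : e₀ ∈ idempotents s)
    (p : Retract s e₀ × Retract s e₀) : Retract s e₀ × Retract s e₀ :=
  (Quot.map₂ (mul s)
    (fun a b c h => by
      rw [retractRel_iff hs he₀] at h ⊢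
      rw [idem_mul, idem_mul]
      refine ⟨rfl, ?_⟩
      rw [mul_left_cancel_of_idempotent hs (mul_left_cancel_of_idempotent hs h.2 a)])
    (fun a b c h => by
      rw [retractRel_iff hs he₀] at h ⊢
      rw [idem_mul, idem_mul, ← mul_assoc hs, h.2, mul_assoc hs]
      exact ⟨h.1, rfl⟩) p.1 p.2,
  Quot.map₂ (theta s)
    (fun a b c h => by
      have h' := (retractRel_iff hs he₀ _ _).1 h
      rw [retractRel_iff hs he₀, idem_theta, idem_theta]
      refine ⟨theta_theta_congr hs (idem_mem hs b) (idem_mem hs c) rfl h'.1, ?_⟩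
      rw [← mul_theta_mul hs (one_mem hs he₀).2, h'.2, mul_theta_mul hs (one_mem hs he₀).2])
    (fun a b c h => by rw [h.theta_eq hs]; exact (retractRel_equivalence hs he₀).refl _)
    p.1 p.2)

theorem retractMap_toRetract (hs : IsSolution s) (he₀ : e₀ ∈ idempotents s) (p : S × S) :
    retractMap hs he₀ (Prod.map (toRetract s e₀) (toRetract s e₀) p) =
      Prod.map (toRetract s e₀) (toRetract s e₀) (s p) := rfl

/-- The bijective solution induced on the retract. -/
noncomputable def retractSol (hs : IsSolution s) (he₀ : e₀ ∈ idempotents s) :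
    Equiv.Perm (Retract s e₀ × Retract s e₀) :=
  Equiv.ofBijective (retractMap hs he₀) (Finite.surjective_iff_bijective.1 fun q => by
    obtain ⟨p, rfl⟩ :=
      (toRetract_surjective (s := s) (e₀ := e₀)).prodMap toRetract_surjective q
    exact ⟨_, (retractMap_toRetract hs he₀ (s.symm p)).trans (by rw [s.apply_symm_apply])⟩)

theorem retractSol_isHom (hs : IsSolution s) (he₀ : e₀ ∈ idempotents s) :
    IsHom s (retractSol hs he₀) (toRetract s e₀) := retractMap_toRetract hs he₀

theorem mul_retractSol (hs : IsSolution s) (he₀ : e₀ ∈ idempotents s) (x y : S) :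
    mul (retractSol hs he₀) (toRetract s e₀ x) (toRetract s e₀ y) = toRetract s e₀ (mul s x y) :=
  rfl

theorem theta_retractSol (hs : IsSolution s) (he₀ : e₀ ∈ idempotents s) (x y : S) :
    theta (retractSol hs he₀) (toRetract s e₀ x) (toRetract s e₀ y) =
      toRetract s e₀ (theta s x y) :=
  rfl

theorem retractSol_isSolution (hs : IsSolution s) (he₀ : e₀ ∈ idempotents s) :
    IsSolution (retractSol hs he₀) := by
  apply isSolution_of_identities <;> intro x y z <;>
    obtain ⟨x, rfl⟩ := toRetract_surjective x <;>
    obtain ⟨y, rfl⟩ := toRetract_surjective y <;>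
    obtain ⟨z, rfl⟩ := toRetract_surjective z <;>
    simp only [mul_retractSol, theta_retractSol]
  · rw [mul_assoc hs]
  · rw [theta_mul hs]
  · rw [theta_theta hs]

theorem toRetract_mem_idempotents (hs : IsSolution s) (he₀ : e₀ ∈ idempotents s) {e : S}
    (he : e ∈ idempotents s) : toRetract s e₀ e ∈ idempotents (retractSol hs he₀) :=
  congrArg (toRetract s e₀) he

theorem exists_idempotent_toRetract_eq (hs : IsSolution s) (he₀ : e₀ ∈ idempotents s)
    {x : Retract s e₀} (hx : x ∈ idempotents (retractSol hs he₀)) :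
    ∃ e ∈ idempotents s, toRetract s e₀ e = x := by
  obtain ⟨x, rfl⟩ := toRetract_surjective x
  refine ⟨x, ?_, rfl⟩
  have h := ((toRetract_eq_iff hs he₀ _ _).1 (hx : toRetract s e₀ (mul s x x) = _)).2
  have h' := mul_left_cancel_of_idempotent hs h x
  rw [← mul_assoc hs] at h'
  exact mul_right_cancel hs h'

theorem retractSol_isIrretractable (hs : IsSolution s) (he₀ : e₀ ∈ idempotents s) :
    IsIrretractable (retractSol hs he₀) (toRetract s e₀ e₀) := by
  have hu := one_mem hs he₀
  intro x y
  constructor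
  · rintro ⟨e, he, f, hf, g, -, h, -, rfl, rfl, hef, rfl⟩
    obtain ⟨e, he', rfl⟩ := exists_idempotent_toRetract_eq hs he₀ he
    obtain ⟨f, hf', rfl⟩ := exists_idempotent_toRetract_eq hs he₀ hf
    obtain ⟨g, rfl⟩ := toRetract_surjective g
    -- Evaluation at `1` suffices: `θ_{θ_e(1)}` is the inverse of `θ_e`, and the class of the
    -- idempotent `θ_e(1)` determines it.
    have h := congrFun hef (toRetract s e₀ (one s e₀))
    rw [theta_retractSol, theta_retractSol, toRetract_eq_iff hs he₀, idem_theta, idem_theta,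
      idem_of_mem hs hu.2] at h
    rw [mul_retractSol, mul_retractSol, toRetract_eq_iff hs he₀, idem_mul, idem_mul,
      idem_of_mem hs he', idem_of_mem hs hf']
    refine ⟨?_, by
      rw [← mul_assoc hs, ← mul_assoc hs, mul_idempotent hs he', mul_idempotent hs hf']⟩
    funext z
    apply (theta_bijective hs (theta s e (one s e₀))).1
    rw [theta_theta_mul_eq_id hs hu, h.1, theta_theta_mul_eq_id hs hu]
  · rintro rfl
    exact (retractRel_equivalence (retractSol_isSolution hs he₀)
      (toRetract_mem_idempotents hs he₀ he₀)).refl _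

end RetractSolution

/-! ### The groups `A` and `G`, and the matched pair. -/

section MatchedPairOfIrretractable

variable {S : Type u} [Finite S] {s : Equiv.Perm (S × S)}

theorem mul_range_fix (hs : IsSolution s) {w : S} (hw : w ∈ idempotents s) {x : S}
    (hx : x ∈ Set.range (mul s w)) : mul s w x = x := by
  obtain ⟨x, rfl⟩ := hx
  exact mul_mul_idempotent_mul hs hw w x

/-- The group `w · S` for an idempotent `w`. -/
@[reducible]
noncomputable def rangeGroup (hs : IsSolution s) {w : S} (hw : w ∈ idempotents s) :
    Group (Set.range (mul s w)) :=
  letI : Mul (Set.range (mul s w)) :=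
    ⟨fun x y => ⟨mul s x y, mul s x y, by rw [← mul_assoc hs, mul_range_fix hs hw x.2]⟩⟩
  letI : One (Set.range (mul s w)) := ⟨⟨w, w, hw⟩⟩
  letI : Inv (Set.range (mul s w)) := ⟨fun x => ⟨_, (exists_mul_eq hs (x : S) w).choose, rfl⟩⟩
  Group.ofLeftAxioms
    (fun x y z => Subtype.ext (mul_assoc hs x y z))
    (fun x => Subtype.ext (mul_range_fix hs hw x.2))
    (fun x => Subtype.ext (by
      change mul s (mul s w _) (x : S) = w
      rw [mul_assoc hs, (exists_mul_eq hs (x : S) w).choose_spec, show mul s w w = w from hw]))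

variable {e₀ : S}

theorem one_mem_circ (hs : IsSolution s) (he₀ : e₀ ∈ idempotents s) :
    one s e₀ ∈ idempotents (dual s) :=
  circ_self_of_theta_eq_id hs (one_mem hs he₀).1

/-- The group `G = 1 · S`. -/
@[reducible]
noncomputable def dotGroup (hs : IsSolution s) (he₀ : e₀ ∈ idempotents s) : Group (dotSet s e₀) :=
  rangeGroup hs (one_mem hs he₀).2

/-- The group `A = 1 ∘ S`. -/
@[reducible]
noncomputable def circGroup (hs : IsSolution s) (he₀ : e₀ ∈ idempotents s) :
    Group (circSet s e₀) :=
  rangeGroup (isSolution_dual hs) (one_mem_circ hs he₀)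

/-- The projection of `S` onto `1 · S`. -/
def toDot (s : Equiv.Perm (S × S)) (e₀ : S) (x : S) : dotSet s e₀ := ⟨mul s (one s e₀) x, x, rfl⟩

/-- The projection of `S` onto `1 ∘ S`. -/
def toCirc (s : Equiv.Perm (S × S)) (e₀ : S) (x : S) : circSet s e₀ :=
  ⟨circ s (one s e₀) x, x, rfl⟩

theorem theta_toCirc (hs : IsSolution s) (he₀ : e₀ ∈ idempotents s)
    (x : S) : theta s (toCirc s e₀ x) = theta s x :=
  theta_circ_of_mem_ker hs (one_mem hs he₀).1 x

theorem toCirc_coe (hs : IsSolution s) (he₀ : e₀ ∈ idempotents s)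
    (a : circSet s e₀) : toCirc s e₀ a = a :=
  Subtype.ext (mul_range_fix (isSolution_dual hs) (one_mem_circ hs he₀) a.2)

theorem toDot_coe (hs : IsSolution s) (he₀ : e₀ ∈ idempotents s)
    (x : dotSet s e₀) : toDot s e₀ x = x :=
  Subtype.ext (mul_range_fix hs (one_mem hs he₀).2 x.2)

theorem toCirc_eq (hs : IsSolution s) (he₀ : e₀ ∈ idempotents s)
    {x y : S} (h : theta s x = theta s y) : toCirc s e₀ x = toCirc s e₀ y :=
  Subtype.ext (circ_eq_of_theta_eq hs (one_mem hs he₀).1 h)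

theorem circSet_ext (hs : IsSolution s) (he₀ : e₀ ∈ idempotents s)
    {a b : circSet s e₀} (h : theta s a = theta s b) : a = b := by
  rw [← toCirc_coe hs he₀ a, toCirc_eq hs he₀ h, toCirc_coe hs he₀]

theorem circSet_mem_idempotents (hs : IsSolution s) (he₀ : e₀ ∈ idempotents s)
    (a : circSet s e₀) : (a : S) ∈ idempotents s := by
  rw [← toCirc_coe hs he₀ a]
  exact circ_mem_idempotents hs (one_mem hs he₀).2 _

theorem toDot_theta_mul_dot (hs : IsSolution s) (he₀ : e₀ ∈ idempotents s)
    (x y : S) : toDot s e₀ (theta s x (toDot s e₀ y)) =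
    toDot s e₀ (theta s x y) :=
  Subtype.ext (mul_theta_mul hs (one_mem hs he₀).2 x y)

theorem toDot_mul_idempotent_left (hs : IsSolution s) {e : S} (he : e ∈ idempotents s) (y : S) :
    toDot s e₀ (mul s e y) = toDot s e₀ y :=
  Subtype.ext (mul_mul_idempotent_mul hs he _ y)

theorem theta_toCirc_mul (hs : IsSolution s) (he₀ : e₀ ∈ idempotents s)
    (z y : S) :
    theta s (mul s (toCirc s e₀ z) y) = theta s (mul s z y) :=
  theta_mul_congr hs (theta_toCirc hs he₀ z) y

/-- The matched pair attached to a bijective solution. -/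
noncomputable def matchedPair (hs : IsSolution s) (he₀ : e₀ ∈ idempotents s) :
    letI := circGroup hs he₀
    letI := dotGroup hs he₀
    MatchedPair (circSet s e₀) (dotSet s e₀) :=
  letI := circGroup hs he₀
  letI := dotGroup hs he₀
  have h_one : theta s (one s e₀) = id := (one_mem hs he₀).1
  have δ_mul : ∀ (x y : dotSet s e₀) (a : circSet s e₀),
      toCirc s e₀ (mul s a (x * y : dotSet s e₀)) =
        toCirc s e₀ (mul s (toCirc s e₀ (mul s a x)) y) := fun x y a => by
    apply circSet_ext hs he₀
    rw [theta_toCirc hs he₀, theta_toCirc hs he₀, theta_toCirc_mul hs he₀, mul_assoc hs]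
    rfl
  have δ_one : ∀ a : circSet s e₀, toCirc s e₀ (mul s a (1 : dotSet s e₀)) = a := fun a => by
    rw [show mul s a (1 : dotSet s e₀) = a from mul_idempotent hs (one_mem hs he₀).2 _,
      toCirc_coe hs he₀]
  { σ := MonoidHom.toHomPerm
      { toFun := fun a x => toDot s e₀ (theta s a x)
        map_one' := by
          funext x
          change toDot s e₀ (theta s (one s e₀) x) = x
          rw [h_one, id, toDot_coe hs he₀]
        map_mul' := fun a b => by
          funext x
          change toDot s e₀ (theta s (circ s a b) x) =
            toDot s e₀ (theta s a (toDot s e₀ (theta s b x)))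
          rw [theta_circ hs, toDot_theta_mul_dot hs he₀] }
    δ := fun x =>
      { toFun := fun a => toCirc s e₀ (mul s a x)
        invFun := fun a => toCirc s e₀ (mul s a (x⁻¹ : dotSet s e₀))
        left_inv := fun a => by
          change toCirc s e₀ (mul s (toCirc s e₀ (mul s a x)) (x⁻¹ : dotSet s e₀)) = a
          rw [← δ_mul, mul_inv_cancel, δ_one]
        right_inv := fun a => by
          change toCirc s e₀ (mul s (toCirc s e₀ (mul s a (x⁻¹ : dotSet s e₀))) x) = a
          rw [← δ_mul, inv_mul_cancel, δ_one] }
    δ_one := Equiv.ext δ_one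
    δ_mul := fun x y a => δ_mul x y a
    σ_mul_right := fun a x y => by
      apply Subtype.ext
      change mul s (one s e₀) (theta s a (mul s x y)) =
        mul s (mul s (one s e₀) (theta s a x))
          (mul s (one s e₀) (theta s (toCirc s e₀ (mul s a x)) y))
      rw [theta_toCirc hs he₀, theta_mul hs, mul_mul_idempotent_mul hs (one_mem hs he₀).2,
        mul_assoc hs]
    δ_mul_right := fun x a b => by
      apply circSet_ext hs he₀
      change theta s (toCirc s e₀ (mul s (circ s a b) x)) =
        theta s (circ s (toCirc s e₀ (mul s a (mul s (one s e₀) (theta s b x))))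
          (toCirc s e₀ (mul s b x)))
      have hx : theta s x = id := by
        rw [← toDot_coe hs he₀ x]
        exact theta_mul_eq_id hs h_one _
      funext z
      rw [theta_circ hs]
      simp only [theta_toCirc hs he₀]
      rw [mul_mul_idempotent_mul hs (one_mem hs he₀).2]
      -- After this injective map is applied, both sides collapse to `θ_x(z)` by the pentagon
      -- identity.
      apply (theta_bijective hs (theta s a (theta s b x))).1
      rw [theta_theta hs a, theta_theta hs b, ← theta_circ hs a b x,
        theta_theta hs (circ s a b)] }

theorem matchedPair_δ (hs : IsSolution s) (he₀ : e₀ ∈ idempotents s) (a : circSet s e₀)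
    (x : dotSet s e₀) :
    letI := circGroup hs he₀
    letI := dotGroup hs he₀
    (matchedPair hs he₀).δ x a = toCirc s e₀ (mul s a x) := rfl

theorem IsIrretractable.eq_of_theta_eq (h : IsIrretractable s e₀) (hs : IsSolution s)
    (he₀ : e₀ ∈ idempotents s) {e f : S} (he : e ∈ idempotents s) (hf : f ∈ idempotents s)
    (hef : theta s e = theta s f) : e = f := by
  rw [← h, retractRel_iff hs he₀, idem_of_mem hs he, idem_of_mem hs hf,
    mul_idempotent hs he, mul_idempotent hs hf]
  exact ⟨hef, rfl⟩

theorem theta_mul_inv_circ (hs : IsSolution s) (he₀ : e₀ ∈ idempotents s) (a : circSet s e₀)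
    (z : S) :
    letI := circGroup hs he₀
    theta s a (theta s (a⁻¹ : circSet s e₀) z) = z := by
  let _ := circGroup hs he₀
  change theta s a (theta s (a⁻¹ : circSet s e₀) z) = z
  rw [← theta_circ hs]
  change theta s (a * a⁻¹ : circSet s e₀) z = z
  rw [mul_inv_cancel]
  exact congrFun (one_mem hs he₀).1 z

theorem theta_inv_eq (hs : IsSolution s) (he₀ : e₀ ∈ idempotents s) {a : circSet s e₀} {y : S}
    (h : ∀ z, theta s y (theta s a z) = z) :
    letI := circGroup hs he₀
    theta s (a⁻¹ : circSet s e₀) = theta s y := by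
  let _ := circGroup hs he₀
  change theta s (a⁻¹ : circSet s e₀) = theta s y
  funext z
  rw [← h (theta s (a⁻¹ : circSet s e₀) z), theta_mul_inv_circ hs he₀]

theorem isMatchedPairOf_matchedPair (hs : IsSolution s) (he₀ : e₀ ∈ idempotents s)
    (hirr : IsIrretractable s e₀) :
    letI := circGroup hs he₀
    letI := dotGroup hs he₀
    IsMatchedPairOf s e₀ (matchedPair hs he₀) := by
  let _ := circGroup hs he₀
  let _ := dotGroup hs he₀
  have hu := one_mem hs he₀
  refine ⟨fun a b => rfl, fun x y => rfl, fun a x => rfl, fun x a => ?_, ?_, ?_⟩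
  · change _ = ((toCirc s e₀ (psi s (x⁻¹ : dotSet s e₀) (a⁻¹ : circSet s e₀)) : circSet s e₀) : S)
    refine congrArg Subtype.val (circSet_ext hs he₀ ?_)
    rw [theta_toCirc hs he₀]
    apply theta_inv_eq hs he₀
    intro z
    rw [matchedPair_δ, theta_toCirc hs he₀]
    refine theta_psi_theta_mul hs hu (circSet_mem_idempotents hs he₀ _)
      (theta_mul_inv_circ hs he₀ a) ?_ z
    rw [mul_range_fix hs hu.2 x.2]
    exact congrArg Subtype.val (mul_inv_cancel x)
  · rintro ⟨⟨a, x⟩, ⟨b, y⟩⟩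
    have hb := circSet_mem_idempotents hs he₀ b
    refine Prod.ext ?_ ?_
    · change mul s (mul s a x) (mul s b y) = mul s a (mul s x y)
      rw [mul_mul_idempotent_mul hs hb, mul_assoc hs]
    · change theta s (mul s a x) (mul s b y) =
        mul s (b * ((matchedPair hs he₀).δ x a)⁻¹ : circSet s e₀)
          (mul s (one s e₀) (theta s (toCirc s e₀ (mul s a x)) y))
      rw [theta_idempotent_mul hs hb, mul_mul_idempotent_mul hs hu.2, theta_toCirc hs he₀]
      congr 1
      -- Irretractability reduces equality of these idempotents to equality of their maps `θ`.
      refine hirr.eq_of_theta_eq hs he₀ (theta_mem_idempotents hs _ hb)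
        (circSet_mem_idempotents hs he₀ _) ?_
      funext z
      obtain ⟨z, rfl⟩ := (theta_bijective hs (mul s a x)).2 z
      rw [theta_theta_idempotent hs hb]
      change _ = theta s (circ s b (((matchedPair hs he₀).δ x a)⁻¹ : circSet s e₀)) _
      rw [theta_circ hs]
      have h := theta_mul_inv_circ hs he₀ ((matchedPair hs he₀).δ x a)⁻¹ z
      rw [inv_inv, matchedPair_δ, theta_toCirc hs he₀] at h
      rw [matchedPair_δ, h]
  · constructor
    · rintro ⟨a, x⟩ ⟨b, y⟩ h
      replace h : mul s a x = mul s b y := h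
      have ha := circSet_mem_idempotents hs he₀ a
      have hb := circSet_mem_idempotents hs he₀ b
      have h₁ := congrArg (idem hs) h
      rw [idem_mul, idem_mul, idem_of_mem hs ha, idem_of_mem hs hb] at h₁
      have h₂ := congrArg (toDot s e₀) h
      rw [toDot_mul_idempotent_left hs ha, toDot_mul_idempotent_left hs hb,
        toDot_coe hs he₀, toDot_coe hs he₀] at h₂
      exact Prod.ext (Subtype.ext h₁) h₂
    · intro z
      refine ⟨(toCirc s e₀ (idem hs z), toDot s e₀ z), ?_⟩
      have h : ((toCirc s e₀ (idem hs z) : circSet s e₀) : S) = idem hs z :=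
        hirr.eq_of_theta_eq hs he₀ (circSet_mem_idempotents hs he₀ _) (idem_mem hs z)
          (theta_toCirc hs he₀ _)
      change mul s (toCirc s e₀ (idem hs z)) (mul s (one s e₀) z) = z
      rw [h, idem_mul_mul hs hu.2]

end MatchedPairOfIrretractable

/-! ### The extension of the retract by `ker θ ∩ E(S, ·)`. -/

section Extension

variable {S : Type u} [Finite S] {s : Equiv.Perm (S × S)} {e₀ : S}

/-- The coordinate of `x` in `ker θ ∩ E(S, ·)`: the image `θ_e(e)` of its idempotent component. -/
noncomputable def kerCoord (hs : IsSolution s) (x : S) : ↥(kerTheta s ∩ idempotents s) :=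
  ⟨one s (idem hs x), one_mem hs (idem_mem hs x)⟩

theorem kerCoord_mul (hs : IsSolution s) (x y : S) : kerCoord hs (mul s x y) = kerCoord hs x :=
  Subtype.ext (congrArg (one s) (idem_mul hs x y))

theorem kerCoord_theta (hs : IsSolution s) (x y : S) :
    kerCoord hs (theta s x y) = kerCoord hs y := by
  apply Subtype.ext
  change theta s (idem hs (theta s x y)) (idem hs (theta s x y)) = theta s (idem hs y) (idem hs y)
  rw [idem_theta, theta_theta_idempotent hs (idem_mem hs y)]

theorem eq_of_kerCoord_eq_of_toRetract_eq (hs : IsSolution s) (he₀ : e₀ ∈ idempotents s) {x y : S}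
    (h₁ : kerCoord hs x = kerCoord hs y) (h₂ : toRetract s e₀ x = toRetract s e₀ y) : x = y := by
  obtain ⟨h₃, h₄⟩ := (toRetract_eq_iff hs he₀ x y).1 h₂
  have hu := (one_mem hs he₀).2
  have h₅ : theta s (idem hs x) (idem hs x) = theta s (idem hs y) (idem hs y) :=
    congrArg Subtype.val h₁
  rw [h₃] at h₅
  rw [← idem_mul_mul hs hu x, ← idem_mul_mul hs hu y, (theta_bijective hs _).1 h₅, h₄]

theorem exists_kerCoord_eq_toRetract_eq (hs : IsSolution s) (he₀ : e₀ ∈ idempotents s)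
    (α : ↥(kerTheta s ∩ idempotents s)) (z : Retract s e₀) :
    ∃ x, kerCoord hs x = α ∧ toRetract s e₀ x = z := by
  obtain ⟨y, rfl⟩ := toRetract_surjective z
  have hu := (one_mem hs he₀).2
  -- Replacing `idem y` by this `e` keeps the retract class, because `α ∈ ker θ` forces `θ_e =
  -- θ_{idem y}`.
  obtain ⟨e, he, heα⟩ := exists_idempotent_theta_eq hs (idem hs y) α.2.2
  have hey : theta s e = theta s (idem hs y) := by
    funext z
    rw [← theta_theta_idempotent hs he (idem hs y), heα, show theta s (α : S) = id from α.2.1, id]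
  refine ⟨mul s e y, ?_, ?_⟩
  · rw [kerCoord_mul]
    apply Subtype.ext
    change theta s (idem hs e) (idem hs e) = α
    rw [idem_of_mem hs he, hey, heα]
  · rw [toRetract_eq_iff hs he₀, idem_mul, idem_of_mem hs he, mul_mul_idempotent_mul hs he]
    exact ⟨hey, rfl⟩

/-- If the retract is identified with the solution of a matched pair, then `S` is identified with
its extension by `ker θ ∩ E(S, ·)`. -/
theorem isIso_ext_one (hs : IsSolution s) (he₀ : e₀ ∈ idempotents s) {A G : Type u} [Group A]
    [Group G] (M : MatchedPair A G) {m : A × G → Retract s e₀}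
    (hm : IsIso M.sol (retractSol hs he₀) m) {c : S → A × G}
    (hc : ∀ x, m (c x) = toRetract s e₀ x) :
    IsIso s (M.ext fun _ => (1 : Equiv.Perm ↥(kerTheta s ∩ idempotents s)))
      (fun x => (kerCoord hs x, c x)) := by
  refine ⟨fun ⟨x, y⟩ => ?_, fun x y h => ?_, fun ⟨α, q⟩ => ?_⟩
  · have key : M.sol (c x, c y) = Prod.map c c (s (x, y)) := by
      apply (hm.2.1.prodMap hm.2.1)
      rw [← hm.1]
      simp only [Prod.map_apply, hc]
      rw [Prod.map_map, show m ∘ c = toRetract s e₀ from funext hc]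
      exact retractSol_isHom hs he₀ (x, y)
    have h₁ : (M.sol (c x, c y)).1 = c (mul s x y) := congrArg Prod.fst key
    have h₂ : (M.sol (c x, c y)).2 = c (theta s x y) := congrArg Prod.snd key
    change ((kerCoord hs x, (M.sol (c x, c y)).1), (kerCoord hs y, (M.sol (c x, c y)).2)) =
      ((kerCoord hs (mul s x y), c (mul s x y)), (kerCoord hs (theta s x y), c (theta s x y)))
    rw [kerCoord_mul, kerCoord_theta, h₁, h₂]
  · obtain ⟨h₁, h₂⟩ := Prod.ext_iff.1 h
    refine eq_of_kerCoord_eq_of_toRetract_eq hs he₀ h₁ ?_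
    rw [← hc, ← hc]
    exact congrArg m h₂
  · obtain ⟨x, hx, hxq⟩ := exists_kerCoord_eq_toRetract_eq hs he₀ α (m q)
    exact ⟨x, Prod.ext hx (hm.2.1 ((hc x).trans hxq))⟩

end Extension

end PE

theorem mainTheorem5 {S : Type u} [Finite S] [Nonempty S] (s : Equiv.Perm (S × S))
    (hs : PE.IsSolution s) :
    (PE.idempotents s).Nonempty ∧
    ∀ e₀ ∈ PE.idempotents s,
      Equivalence (PE.RetractRel s e₀) ∧
      -- the induced bijective solution on the retract
      ∃ sbar : Equiv.Perm (PE.Retract s e₀ × PE.Retract s e₀),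
        PE.IsSolution sbar ∧
        PE.IsHom s sbar (PE.toRetract s e₀) ∧
        PE.IsIrretractable sbar (PE.toRetract s e₀ e₀) ∧
        -- its matched pair
        ∃ (_ : Group (PE.circSet sbar (PE.toRetract s e₀ e₀)))
          (_ : Group (PE.dotSet sbar (PE.toRetract s e₀ e₀)))
          (M : PE.MatchedPair (PE.circSet sbar (PE.toRetract s e₀ e₀))
            (PE.dotSet sbar (PE.toRetract s e₀ e₀))),
          PE.IsMatchedPairOf sbar (PE.toRetract s e₀ e₀) M ∧
          -- the given solution is the extension of the retract by `ker θ ∩ E(S, ·)`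
          ∃ (φ : PE.circSet sbar (PE.toRetract s e₀ e₀) →
                Equiv.Perm ↥(PE.kerTheta s ∩ PE.idempotents s))
            (F : S → ↥(PE.kerTheta s ∩ PE.idempotents s) ×
                PE.circSet sbar (PE.toRetract s e₀ e₀) × PE.dotSet sbar (PE.toRetract s e₀ e₀)),
            PE.IsIso s (M.ext φ) F ∧
            ∀ p : S, PE.toRetract s e₀ p = PE.mul sbar (F p).2.1 (F p).2.2 := by

  refine ⟨PE.idempotents_nonempty hs, fun e₀ he₀ => ⟨PE.retractRel_equivalence hs he₀,
    PE.retractSol hs he₀, PE.retractSol_isSolution hs he₀, PE.retractSol_isHom hs he₀,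
    PE.retractSol_isIrretractable hs he₀, ?_⟩⟩
  have ht := PE.retractSol_isSolution hs he₀
  have he := PE.toRetract_mem_idempotents hs he₀ he₀
  let _ := PE.circGroup ht he
  let _ := PE.dotGroup ht he
  have hM := PE.isMatchedPairOf_matchedPair ht he (PE.retractSol_isIrretractable hs he₀)
  -- Here `c` is the projection to the retract read in the coordinates `A × G`.
  choose c hc using fun x => hM.isIso.2.2 (PE.toRetract s e₀ x)
  exact ⟨PE.circGroup ht he, PE.dotGroup ht he, PE.matchedPair ht he, hM, fun _ => 1, _,
    PE.isIso_ext_one hs he₀ _ hM.isIso hc, fun p => (hc p).symm⟩
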